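/- Let $d\geq 4$ be an integer, let $c=(1/2,\dots,1/2)$ be the center of the hypercube $[0,1]^d$, and set $$ r_d=\frac{1}{\sqrt{d}}\min\left\{\frac{d-1}{4},\frac{d^{1/(d-3)}}{d^{1/(d-3)}-1}\right\}. $$ A diagonal of $[0,1]^d$ is a line segment between two opposite vertices. For $t>0$, each hyperplane of $\mathbb{R}^d$ at distance $t$ from $c$ is of the form $H_a=\{x\in\mathbb{R}^d : a\cdot(x-c)=t\}$ for a unique unit vector $a\in\mathbb{S}^{d-1}$. If $$ \frac{\sqrt{d}}{2}-r_d<t<\frac{\sqrt{d}}{2}, $$ then, among the hyperplanes $H$ at distance $t$ from $c$, the $(d-1)$-dimensional volume of $H\cap[0,1]^d$ has a strict local maximum at every hyperplane orthogonal to a diagonal of $[0,1]^d$. That is, if $a\in\mathbb{S}^{d-1}$ is such that $H_a$ is orthogonal to a diagonal, then for every $b\in\mathbb{S}^{d-1}\setminus\{a\}$ close enough to $a$ the $(d-1)$-dimensional volume of $H_b\cap[0,1]^d$ is strictly less than that of $H_a\cap[0,1]^d$. Moreover, the length $r_d$ of this range for $t$ is asymptotic to $\sqrt{d}/\log d$: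 the ratio $r_d\,\log(d)/\sqrt{d}$ tends to $1$ as $d\to\infty$. -/

import Mathlib

open Set Filter Topology MeasureTheory Asymptotics

/-- The hypercube `[0,1]^d` in Euclidean `d`-space. -/
def unitCube (d : ℕ) : Set (EuclideanSpace ℝ (Fin d)) :=
  {x | ∀ i, x i ∈ Icc (0 : ℝ) 1}

/-- The center `(1/2, …, 1/2)` of the hypercube. -/
noncomputable def cubeCenter (d : ℕ) : EuclideanSpace ℝ (Fin d) :=
  WithLp.toLp 2 (fun _ => 1 / 2)

/-- For a unit vector `a`, the hyperplane with unit normal `a` that is tangent, at the point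
`cubeCenter d + t • a`, to the sphere of radius `t` around the center of the hypercube.
For `t > 0`, every hyperplane at distance `t` from the center is obtained in this way from exactly
one unit vector `a`. -/
def tangentHyperplane (d : ℕ) (t : ℝ) (a : EuclideanSpace ℝ (Fin d)) :
    Set (EuclideanSpace ℝ (Fin d)) :=
  {x | inner ℝ a (x - cubeCenter d) = t}

/-- The `(d-1)`-dimensional volume of the section of the hypercube by the hyperplane at distance
`t` from its center with unit normal `a`; `μHE[k]` is the `k`-dimensional Hausdorff measure,
normalized so as to be Lebesgue measure on `k`-dimensional Euclidean spaces. -/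
noncomputable def sectionVolume (d : ℕ) (t : ℝ) (a : EuclideanSpace ℝ (Fin d)) : ENNReal :=
  μHE[d - 1] (tangentHyperplane d t a ∩ unitCube d)

/-- `v` and `w` are opposite vertices of the hypercube, so that the segment between them is a
diagonal. -/
def IsOppositeVertices (d : ℕ) (v w : EuclideanSpace ℝ (Fin d)) : Prop :=
  ∀ i, (v i = 0 ∧ w i = 1) ∨ (v i = 1 ∧ w i = 0)

/-- The set `H` (a hyperplane) is orthogonal to a diagonal of the hypercube. -/
def IsOrthogonalToDiagonal (d : ℕ) (H : Set (EuclideanSpace ℝ (Fin d))) : Prop :=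
  ∃ v w, IsOppositeVertices d v w ∧ ∀ x ∈ H, ∀ y ∈ H, inner ℝ (w - v) (y - x) = 0

/-- `f` has a strict local maximum on the set `s` at `a`. -/
def IsStrictLocalMaxOn {X Y : Type*} [TopologicalSpace X] [Preorder Y]
    (f : X → Y) (s : Set X) (a : X) : Prop :=
  ∀ᶠ b in 𝓝[s \ {a}] a, f b < f a

/-- The length of the interval of admissible values of `t` in dimension `d`. -/
noncomputable def rangeLength (d : ℕ) : ℝ :=
  1 / √(d : ℝ) * min (((d : ℝ) - 1) / 4)
    ((d : ℝ) ^ (1 / ((d : ℝ) - 3)) / ((d : ℝ) ^ (1 / ((d : ℝ) - 3)) - 1))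

/-!
After reflections, the hyperplane with unit normal `b` close to a diagonal direction cuts off the
vertex `0` of the cube and reads `β ⬝ x = (∑ i, β i) / 2 - √d * t`, where `β i = √d * |b i|` is close
to `1` and `∑ i, β i ^ 2 = d`. The volume of the section is a constant multiple of
`altSum (d - 1) β z / ∏ i, β i`, where `z` is the right-hand side and
`altSum (d - 1) β z = ∑ S, (-1) ^ |S| * (z - β(S))₊ ^ (d - 1)` runs over the vertices of the cube
(`volume_cubeSlice`, by induction on the dimension and Fubini, and
`euclideanHausdorffMeasure_cubeSection`, by writing the section as a graph).

With `β = 1 + h` and `s = d / 2 - √d * t` one has `∑ h i = -‖h‖ ^ 2 / 2` and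
`z = s + (∑ h i) / 2`. For `d ≥ 4` the truncated power is twice continuously differentiable, so the
sum can be expanded to second order (`altSum_expansion`). By symmetry the first moments of `h`
enter only through `∑ h i` and the second moments only through `∑ h i` and `‖h‖ ^ 2`, so that the
volume changes by `A * ‖h‖ ^ 2 + o(‖h‖ ^ 2)`, up to a positive factor, where, in terms of the
unnormalized cardinal B-splines `B_n` of degree `n`,
`A = (s - (d-1)/4) B_{d-2}(s) + (d - s - (d-1)/4) B_{d-2}(s-1) - (d-1)(d-2)/2 B_{d-3}(s-1)`.
The range of `t` gives `0 < s < (d-1)/4`. There the first summand is negative, and the third one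
outweighs the second (`bspline_combination_neg`): on that interval B-splines grow fast enough, by
`(n + 1 - 2x) B_n(x-1) ≤ x B_n(x)` (`bspline_growth`), which is inherited through the recurrence
`bspline_succ`. Hence `A < 0` and the local maximum is strict.

For the asymptotics of the range, put `u = log d / (d - 3)`, so that `d ^ (1 / (d - 3)) = exp u`; as
`u → 0`, the second term of the minimum is `exp u / (exp u - 1) ~ 1 / u ~ d / log d`, and it is
eventually the smaller one.
-/

/-! ### Truncated powers, differences and B-splines -/

/-- The truncated power `x ↦ x₊ⁿ`. For `n = 0` it is the indicator of `[0, ∞)`, so that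
`x * truncPow n x = truncPow (n + 1) x` holds for every `n`. -/
noncomputable def truncPow (n : ℕ) (x : ℝ) : ℝ := if 0 ≤ x then x ^ n else 0

/-- The backward difference operator with unit step. -/
def bwdDiff (f : ℝ → ℝ) (x : ℝ) : ℝ := f x - f (x - 1)

/-- The cardinal B-spline of degree `n`, multiplied by `n!`: up to that factor, the density of the
sum of `n + 1` independent random variables uniform on `[0,1]`. -/
noncomputable def bspline (n : ℕ) : ℝ → ℝ := bwdDiff^[n + 1] (truncPow n)

lemma truncPow_of_nonneg {n : ℕ} {x : ℝ} (hx : 0 ≤ x) : truncPow n x = x ^ n := if_pos hx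

lemma truncPow_of_neg {n : ℕ} {x : ℝ} (hx : x < 0) : truncPow n x = 0 := if_neg hx.not_ge

lemma mul_truncPow (n : ℕ) (x : ℝ) : x * truncPow n x = truncPow (n + 1) x := by
  unfold truncPow; split_ifs <;> ring

lemma bwdDiff_iterate_succ (n : ℕ) (f : ℝ → ℝ) (x : ℝ) :
    bwdDiff^[n + 1] f x = bwdDiff^[n] f x - bwdDiff^[n] f (x - 1) := by
  rw [Function.iterate_succ_apply']; rfl

/-- The Leibniz rule for the iterated difference of `y ↦ y * f y`. -/
lemma bwdDiff_iterate_id_mul (n : ℕ) (f : ℝ → ℝ) (x : ℝ) :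
    bwdDiff^[n + 1] (fun y => y * f y) x =
      x * bwdDiff^[n + 1] f x + (n + 1) * bwdDiff^[n] f (x - 1) := by
  induction n generalizing x with
  | zero => simp [bwdDiff]; ring
  | succ n ih =>
    rw [bwdDiff_iterate_succ, ih, ih, bwdDiff_iterate_succ (n + 1) f,
      bwdDiff_iterate_succ n f (x - 1)]
    push_cast; ring

/-- The Cox–de Boor recurrence. -/
lemma bspline_succ (n : ℕ) (x : ℝ) :
    bspline (n + 1) x = x * bspline n x + (n + 2 - x) * bspline n (x - 1) := by
  have h : truncPow (n + 1) = fun y => y * truncPow n y := by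
    funext y; rw [mul_truncPow]
  rw [bspline, h, bwdDiff_iterate_id_mul, bwdDiff_iterate_succ, bspline]
  push_cast; ring

lemma bspline_zero_apply (x : ℝ) : bspline 0 x = if 0 ≤ x ∧ x < 1 then 1 else 0 := by
  simp only [bspline, bwdDiff, truncPow, Function.iterate_one, zero_add, pow_zero, sub_nonneg]
  split_ifs <;> grind

lemma bspline_of_neg (n : ℕ) {x : ℝ} (hx : x < 0) : bspline n x = 0 := by
  induction n generalizing x with
  | zero => rw [bspline_zero_apply, if_neg (by grind)]
  | succ n ih => rw [bspline_succ, ih hx, ih (by linarith)]; ring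

lemma bspline_of_ge (n : ℕ) {x : ℝ} (hx : n + 1 ≤ x) : bspline n x = 0 := by
  induction n generalizing x with
  | zero => rw [bspline_zero_apply, if_neg (by push_cast at hx; grind)]
  | succ n ih =>
    push_cast at hx
    rw [bspline_succ, ih (by linarith), ih (by linarith)]; ring

lemma bspline_nonneg (n : ℕ) (x : ℝ) : 0 ≤ bspline n x := by
  induction n generalizing x with
  | zero => rw [bspline_zero_apply]; split_ifs <;> norm_num
  | succ n ih =>
    rcases lt_or_ge x 0 with hx | hx
    · rw [bspline_of_neg _ hx]
    rcases le_or_gt ((n : ℝ) + 2) x with hx' | hx'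
    · rw [bspline_of_ge]; push_cast; linarith
    rw [bspline_succ]
    exact add_nonneg (mul_nonneg hx (ih x)) (mul_nonneg (by linarith) (ih _))

lemma bspline_pos (n : ℕ) {x : ℝ} (hx : 0 < x) (hx' : x < n + 1) : 0 < bspline n x := by
  induction n generalizing x with
  | zero => rw [bspline_zero_apply, if_pos ⟨hx.le, by simpa using hx'⟩]; norm_num
  | succ n ih =>
    push_cast at hx'
    rw [bspline_succ]
    rcases lt_or_ge x (n + 1) with h | h
    · exact add_pos_of_pos_of_nonneg (mul_pos hx (ih hx h))
        (mul_nonneg (by linarith) (bspline_nonneg _ _))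
    · refine add_pos_of_nonneg_of_pos (mul_nonneg hx.le (bspline_nonneg _ _))
        (mul_pos (by linarith) ?_)
      rcases eq_or_lt_of_le (sub_nonneg.2 (le_trans (by linarith [n.cast_nonneg (α := ℝ)]) h) :
        0 ≤ x - 1) with h0 | h0
      · have hn : n = 0 := by
          have : (n : ℝ) ≤ 0 := by linarith
          exact_mod_cast le_antisymm this n.cast_nonneg
        subst hn
        rw [← h0, bspline_zero_apply]; norm_num
      · exact ih h0 (by linarith)

/-- A growth bound for B-splines, valid to the left of the middle of the support. The linear
factors are chosen so that the bound is void from the middle on and is inherited through the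
recurrence `bspline_succ`. -/
lemma bspline_growth (n : ℕ) (x : ℝ) :
    (n + 1 - 2 * x) * bspline n (x - 1) ≤ x * bspline n x := by
  induction n generalizing x with
  | zero =>
    rcases lt_or_ge x 1 with hx | hx
    · rw [bspline_of_neg 0 (by linarith : x - 1 < 0)]
      rcases lt_or_ge x 0 with h0 | h0
      · rw [bspline_of_neg 0 h0]; simp
      · simpa using mul_nonneg h0 (bspline_nonneg 0 x)
    · have h1 := bspline_nonneg 0 x
      have h2 := bspline_nonneg 0 (x - 1)
      push_cast
      nlinarith
  | succ n ih =>
    rcases lt_or_ge x 1 with hx | hx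
    · rw [bspline_of_neg (n + 1) (by linarith : x - 1 < 0)]
      rcases lt_or_ge x 0 with h0 | h0
      · rw [bspline_of_neg (n + 1) h0]; simp
      · simpa using mul_nonneg h0 (bspline_nonneg (n + 1) x)
    have h1 := bspline_nonneg (n + 1) x
    have h2 := bspline_nonneg (n + 1) (x - 1)
    push_cast
    -- From the middle of the support on, the left-hand side is nonpositive.
    rcases le_or_gt ((n : ℝ) + 2) (2 * x) with hn | hn
    · nlinarith
    have ha := ih x
    have hc := ih (x - 1)
    rw [bspline_succ, bspline_succ]
    have hb0 := bspline_nonneg n (x - 1)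
    set a := bspline n x
    set b := bspline n (x - 1)
    set c := bspline n (x - 1 - 1)
    set D : ℝ := n + 3 - 2 * x with hD
    have hD1 : 1 < D := by rw [hD]; linarith
    -- Multiplying the goal by `D` makes the bound at `x - 1` applicable to `c`.
    have hc' : D * c ≤ (x - 1) * b := by rw [hD]; linarith
    have key : (D - 1) * (n + 3 - x) * (D * c) ≤ (D - 1) * (n + 3 - x) * ((x - 1) * b) :=
      mul_le_mul_of_nonneg_left hc' (mul_nonneg (by linarith) (by linarith))
    have ha' : D * (x * ((n + 1 - 2 * x) * b)) ≤ D * (x * (x * a)) :=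
      mul_le_mul_of_nonneg_left (mul_le_mul_of_nonneg_left ha (by linarith)) (by linarith)
    have hDpos : 0 < D := by linarith
    refine le_of_mul_le_mul_left ?_ hDpos
    have hpoly : 0 ≤ D * (x * (n + 1 - 2 * x) + x * (n + 2 - x) - (D - 1) * (x - 1)) -
        (D - 1) * (n + 3 - x) * (x - 1) := by
      have : D * (x * (n + 1 - 2 * x) + x * (n + 2 - x) - (D - 1) * (x - 1)) -
        (D - 1) * (n + 3 - x) * (x - 1) = 2 * (D - 1) * D + (x - 1) * (n + 3 - x - D) := by
        rw [hD]; ring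
      rw [this, hD]
      nlinarith
    have := mul_nonneg hpoly hb0
    have hn1 : (n : ℝ) + 1 + 1 - 2 * x = D - 1 := by rw [hD]; ring
    have hn2 : (n : ℝ) + 2 - (x - 1) = n + 3 - x := by ring
    rw [hn1, hn2]
    nlinarith

/-- The second-order coefficient of the section volume at a diagonal in dimension `n + 3` is negative
for `0 < s < (n + 2) / 4`: the first summand is negative, and `bspline_growth` makes the third one dominate
the second. -/
lemma bspline_combination_neg (n : ℕ) {s : ℝ} (hs : 0 < s) (hs' : s < (n + 2) / 4) :
    (s - (n + 2) / 4) * bspline (n + 1) s + (n + 3 - s - (n + 2) / 4) * bspline (n + 1) (s - 1)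
      - (n + 2) * (n + 1) / 2 * bspline n (s - 1) < 0 := by
  have hn : (0 : ℝ) ≤ n := n.cast_nonneg
  have h1 : (s - (n + 2) / 4) * bspline (n + 1) s < 0 :=
    mul_neg_of_neg_of_pos (by linarith) (bspline_pos _ hs (by push_cast; linarith))
  rcases lt_or_ge (s - 1) 0 with h0 | h0
  · rw [bspline_of_neg _ h0, bspline_of_neg _ h0]
    linarith
  have hB := bspline_nonneg n (s - 1)
  have hb := bspline_growth n (s - 1)
  have hrec := bspline_succ n (s - 1)
  have hM := bspline_nonneg (n + 1) (s - 1)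
  set x := s - 1 with hx
  set B := bspline n x
  set b := bspline n (x - 1)
  have hxn : x < (n - 2) / 4 := by linarith
  have hpos : (0 : ℝ) < n + 1 - 2 * x := by linarith
  have hpoly : x * (2 * n + 3 - 3 * x) ≤ 2 / 3 * (n + 1) * (n + 1 - 2 * x) := by
    nlinarith [mul_nonneg h0 (by linarith : (0 : ℝ) ≤ (n - 2) / 4 - x)]
  have h2 : bspline (n + 1) x ≤ 2 / 3 * (n + 1) * B := by
    refine le_of_mul_le_mul_left ?_ hpos
    have e1 := mul_le_mul_of_nonneg_left hb (by linarith : (0 : ℝ) ≤ n + 2 - x)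
    have e2 := mul_le_mul_of_nonneg_right hpoly hB
    rw [hrec]
    nlinarith
  have h3 : (n + 3 - s - (n + 2) / 4) * bspline (n + 1) x ≤
      3 / 4 * (n + 2) * (2 / 3 * (n + 1) * B) :=
    mul_le_mul (by linarith) h2 hM (by linarith)
  linarith

/-! ### Derivatives of truncated powers -/

lemma continuous_truncPow (n : ℕ) : Continuous (truncPow (n + 1)) := by
  have : truncPow (n + 1) = fun x => (max x 0) ^ (n + 1) := by
    funext x
    rcases lt_or_ge x 0 with h | h
    · rw [truncPow_of_neg h, max_eq_right h.le]; simp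
    · rw [truncPow_of_nonneg h, max_eq_left h]
  rw [this]; fun_prop

lemma hasDerivAt_truncPow_of_ne (n : ℕ) {x : ℝ} (hx : x ≠ 0) :
    HasDerivAt (truncPow (n + 1)) ((n + 1) * truncPow n x) x := by
  rcases lt_or_gt_of_ne hx with h | h
  · rw [truncPow_of_neg h, mul_zero]
    refine (hasDerivAt_const x (0 : ℝ)).congr_of_eventuallyEq ?_
    filter_upwards [Iio_mem_nhds h] with y hy using truncPow_of_neg hy
  · rw [truncPow_of_nonneg h.le]
    have := hasDerivAt_pow (n + 1) x
    push_cast at this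
    refine this.congr_of_eventuallyEq ?_
    filter_upwards [Ioi_mem_nhds h] with y hy using truncPow_of_nonneg (le_of_lt hy)

lemma hasDerivAt_truncPow (n : ℕ) (x : ℝ) :
    HasDerivAt (truncPow (n + 2)) ((n + 2) * truncPow (n + 1) x) x := by
  rcases eq_or_ne x 0 with rfl | hx
  · refine hasDerivAt_of_hasDerivAt_of_ne (g := fun x => (n + 2) * truncPow (n + 1) x) (x := 0)
      (fun y hy => ?_) (continuous_truncPow _).continuousAt
      ((continuous_truncPow n).continuousAt.const_mul _)
    refine (hasDerivAt_truncPow_of_ne (n + 1) hy).congr_deriv ?_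
    push_cast; ring
  · refine (hasDerivAt_truncPow_of_ne (n + 1) hx).congr_deriv ?_
    push_cast; ring

lemma deriv_truncPow (n : ℕ) :
    deriv (truncPow (n + 2)) = fun x => (n + 2) * truncPow (n + 1) x :=
  funext fun x => (hasDerivAt_truncPow n x).deriv

lemma contDiff_two_truncPow (n : ℕ) : ContDiff ℝ 2 (truncPow (n + 3)) := by
  have h1 : ContDiff ℝ 1 (truncPow (n + 2)) := by
    rw [contDiff_one_iff_deriv, deriv_truncPow]
    exact ⟨fun x => (hasDerivAt_truncPow n x).differentiableAt,
      continuous_const.mul (continuous_truncPow n)⟩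
  rw [show (2 : WithTop ℕ∞) = 1 + 1 by norm_num, contDiff_succ_iff_deriv, deriv_truncPow]
  exact ⟨fun x => (hasDerivAt_truncPow (n + 1) x).differentiableAt, by simp,
    contDiff_const.mul h1⟩

/-- The second-order Taylor expansion of a truncated power. -/
lemma truncPow_taylor (n : ℕ) (x : ℝ) :
    (fun u => truncPow (n + 3) (x + u) - (truncPow (n + 3) x + (n + 3) * truncPow (n + 2) x * u
      + (n + 3) * (n + 2) / 2 * truncPow (n + 1) x * u ^ 2)) =o[𝓝 0] fun u => u ^ 2 := by
  have h := taylor_isLittleO_univ (n := 2) (x₀ := x) (contDiff_two_truncPow n)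
  have ht : Tendsto (fun u : ℝ => x + u) (𝓝 0) (𝓝 x) := by
    have : Continuous fun u : ℝ => x + u := by fun_prop
    simpa using this.tendsto 0
  have h' := h.comp_tendsto ht
  have d1 : deriv (truncPow (n + 3)) x = (n + 3) * truncPow (n + 2) x := by
    rw [deriv_truncPow (n + 1)]; push_cast; ring
  have d2 : deriv (deriv (truncPow (n + 3))) x = (n + 3) * ((n + 2) * truncPow (n + 1) x) := by
    have e : deriv (truncPow (n + 3)) = fun x => ((n : ℝ) + 3) * truncPow (n + 2) x := by
      rw [deriv_truncPow (n + 1)]; push_cast; ring_nf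
    rw [e, deriv_const_mul _ (hasDerivAt_truncPow n x).differentiableAt, deriv_truncPow]
  refine (h'.congr' ?_ ?_)
  · filter_upwards with u
    simp only [Function.comp_apply, taylorWithinEval_succ, taylor_within_zero_eval,
      iteratedDerivWithin_univ, iteratedDeriv_succ, iteratedDeriv_zero, zero_add, d1, d2]
    norm_num
    ring
  · filter_upwards with u
    simp

/-! ### Alternating sums over subsets -/

/-- The binomial expansion of an iterated difference, as a sum over subsets. -/
lemma sum_powerset_neg_one_pow {ι : Type*} [DecidableEq ι] (T : Finset ι) (f : ℝ → ℝ)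
    (x : ℝ) :
    ∑ S ∈ T.powerset, (-1 : ℝ) ^ S.card * f (x - S.card) = bwdDiff^[T.card] f x := by
  induction T using Finset.induction_on generalizing x with
  | empty => simp
  | insert a T ha ih =>
    rw [Finset.sum_powerset_insert ha, Finset.card_insert_of_notMem ha, bwdDiff_iterate_succ,
      ← ih, ← ih, ← sub_neg_eq_add, ← Finset.sum_neg_distrib]
    congr 1
    refine Finset.sum_congr rfl fun S hS => ?_
    rw [Finset.card_insert_of_notMem (fun h => ha (Finset.mem_powerset.1 hS h))]
    push_cast
    rw [pow_succ, sub_sub x 1, add_comm (1 : ℝ)]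
    ring

/-- The first moment over `S ⊆ T`: each `h i` is weighted by the subsets containing `i`, which
contribute an iterated difference over the remaining elements. -/
lemma sum_powerset_neg_one_pow_mul_sum {ι : Type*} [DecidableEq ι] (T : Finset ι)
    (h : ι → ℝ) (f : ℝ → ℝ) (x : ℝ) :
    ∑ S ∈ T.powerset, (-1 : ℝ) ^ S.card * f (x - S.card) * ∑ i ∈ S, h i =
      - (∑ i ∈ T, h i) * bwdDiff^[T.card - 1] f (x - 1) := by
  induction T using Finset.induction_on generalizing x with
  | empty => simp
  | insert a T ha ih =>
    have hsplit : ∀ S ∈ T.powerset, (-1 : ℝ) ^ (insert a S).card * f (x - (insert a S).card)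
        * ∑ i ∈ insert a S, h i = - h a * ((-1 : ℝ) ^ S.card * f (x - 1 - S.card))
          - (-1 : ℝ) ^ S.card * f (x - 1 - S.card) * ∑ i ∈ S, h i := by
      intro S hS
      have haS : a ∉ S := fun h => ha (Finset.mem_powerset.1 hS h)
      rw [Finset.card_insert_of_notMem haS, Finset.sum_insert haS]
      push_cast
      rw [pow_succ, sub_sub x 1, add_comm (1 : ℝ)]
      ring
    rw [Finset.sum_powerset_insert ha, Finset.sum_congr rfl hsplit, Finset.sum_sub_distrib,
      ← Finset.mul_sum, ih, ih, sum_powerset_neg_one_pow, Finset.card_insert_of_notMem ha,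
      Finset.sum_insert ha]
    rcases T.eq_empty_or_nonempty with rfl | hT
    · simp
    · obtain ⟨k, hk⟩ := Nat.exists_eq_succ_of_ne_zero hT.card_pos.ne'
      rw [hk]
      simp only [Nat.succ_eq_add_one, add_tsub_cancel_right, bwdDiff_iterate_succ]
      ring

/-- The second moment over `S ⊆ T`: the first summand comes from the squares `h i ^ 2`, the second
from the products `h i * h j` with `i ≠ j`. For `T.card ≤ 1` the second coefficient vanishes, so
the truncated subtraction is harmless. -/
lemma sum_powerset_neg_one_pow_mul_sum_sq {ι : Type*} [DecidableEq ι] (T : Finset ι)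
    (h : ι → ℝ) (f : ℝ → ℝ) (x : ℝ) :
    ∑ S ∈ T.powerset, (-1 : ℝ) ^ S.card * f (x - S.card) * (∑ i ∈ S, h i) ^ 2 =
      - (∑ i ∈ T, h i ^ 2) * bwdDiff^[T.card - 1] f (x - 1)
        + ((∑ i ∈ T, h i) ^ 2 - ∑ i ∈ T, h i ^ 2) * bwdDiff^[T.card - 2] f (x - 2) := by
  induction T using Finset.induction_on generalizing x with
  | empty => simp
  | insert a T ha ih =>
    have hsplit : ∀ S ∈ T.powerset, (-1 : ℝ) ^ (insert a S).card * f (x - (insert a S).card)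
        * (∑ i ∈ insert a S, h i) ^ 2 = - h a ^ 2 * ((-1 : ℝ) ^ S.card * f (x - 1 - S.card))
          - 2 * h a * ((-1 : ℝ) ^ S.card * f (x - 1 - S.card) * ∑ i ∈ S, h i)
          - (-1 : ℝ) ^ S.card * f (x - 1 - S.card) * (∑ i ∈ S, h i) ^ 2 := by
      intro S hS
      have haS : a ∉ S := fun h => ha (Finset.mem_powerset.1 hS h)
      rw [Finset.card_insert_of_notMem haS, Finset.sum_insert haS]
      push_cast
      rw [pow_succ, sub_sub x 1, add_comm (1 : ℝ)]
      ring
    rw [Finset.sum_powerset_insert ha, Finset.sum_congr rfl hsplit, Finset.sum_sub_distrib,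
      Finset.sum_sub_distrib, ← Finset.mul_sum, ← Finset.mul_sum, ih, ih,
      sum_powerset_neg_one_pow, sum_powerset_neg_one_pow_mul_sum,
      Finset.card_insert_of_notMem ha, Finset.sum_insert ha, Finset.sum_insert ha]
    have h2 : x - 1 - 1 = x - 2 := by ring
    rcases hc : T.card with _ | _ | k
    · obtain rfl := Finset.card_eq_zero.1 hc
      simp
    · obtain ⟨b, rfl⟩ := Finset.card_eq_one.1 hc
      simp [bwdDiff, h2]
      ring
    · simp only [show k + 1 + 1 - 1 = k + 1 by omega, show k + 1 + 1 - 2 = k by omega,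
        show k + 1 + 1 + 1 - 1 = k + 2 by omega, show k + 1 + 1 + 1 - 2 = k + 1 by omega,
        bwdDiff_iterate_succ, h2]
      ring_nf

/-! ### The alternating sum over the vertices of the cube -/

/-- The alternating sum over the vertices of the cube that computes the volumes of the slices
`{y ∈ [0,1]^k | ∑ i, β i * y i ≤ z}`; each `S` stands for the vertex with support `S`. -/
noncomputable def altSum {k : ℕ} (n : ℕ) (β : Fin k → ℝ) (z : ℝ) : ℝ :=
  ∑ S : Finset (Fin k), (-1 : ℝ) ^ S.card * truncPow n (z - ∑ i ∈ S, β i)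

lemma altSum_one (n : ℕ) (s : ℝ) : altSum n (fun _ : Fin (n + 1) => (1 : ℝ)) s = bspline n s := by
  have h := sum_powerset_neg_one_pow (Finset.univ : Finset (Fin (n + 1))) (truncPow n) s
  rw [Finset.powerset_univ, Finset.card_fin] at h
  rw [bspline, ← h]
  simp [altSum]

/-! ### Second-order expansion at the diagonal -/

lemma sum_isBigO_norm {k : ℕ} (T : Finset (Fin k)) :
    (fun h : EuclideanSpace ℝ (Fin k) => ∑ i ∈ T, h i) =O[𝓝 0] fun h => ‖h‖ := by
  refine IsBigO.fun_sum fun i _ => IsBigO.of_bound 1 (Eventually.of_forall fun h => ?_)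
  simpa using PiLp.norm_apply_le h i

/-- The second-order expansion of `∏ (1 + h i)`. -/
lemma prod_one_add_expansion {k : ℕ} (T : Finset (Fin k)) :
    (fun h : EuclideanSpace ℝ (Fin k) => ∏ i ∈ T, (1 + h i) -
      (1 + ∑ i ∈ T, h i + ((∑ i ∈ T, h i) ^ 2 - ∑ i ∈ T, h i ^ 2) / 2))
      =o[𝓝 0] fun h => ‖h‖ ^ 2 := by
  induction T using Finset.induction_on with
  | empty => simp
  | insert a T ha ih =>
    have h1 : ∀ i, (fun h : EuclideanSpace ℝ (Fin k) => h i) =O[𝓝 0] fun h => ‖h‖ := fun i => by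
      simpa using sum_isBigO_norm {i}
    have h2 : (fun h : EuclideanSpace ℝ (Fin k) =>
        ((∑ i ∈ T, h i) ^ 2 - ∑ i ∈ T, h i ^ 2) / 2) =O[𝓝 0] fun h => ‖h‖ ^ 2 := by
      simp only [div_eq_inv_mul]
      exact (((sum_isBigO_norm T).pow 2).sub
        (IsBigO.fun_sum fun i _ => (h1 i).pow 2)).const_mul_left _
    have h3 : (fun h : EuclideanSpace ℝ (Fin k) => h a) =o[𝓝 0] fun _ => (1 : ℝ) := by
      refine (h1 a).trans_isLittleO ((isLittleO_one_iff ℝ).2 ?_)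
      simpa using (continuous_norm (E := EuclideanSpace ℝ (Fin k))).tendsto 0
    have h4 := h3.mul_isBigO (ih.isBigO.add h2)
    have h5 := ih.add (h4.congr_right fun h => one_mul _)
    refine h5.congr_left fun h => ?_
    rw [Finset.prod_insert ha, Finset.sum_insert ha, Finset.sum_insert ha]
    ring

/-- The second-order expansion of the alternating sum at `β = 1`, when `z` moves along with `β`
as it does for tangent hyperplanes of a sphere around the center of the cube. -/
lemma altSum_expansion (m : ℕ) (s : ℝ) : ∃ C : ℝ,
    (fun h : EuclideanSpace ℝ (Fin (m + 4)) =>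
      altSum (m + 3) (fun i => 1 + h i) (s + (∑ i, h i) / 2) -
        (bspline (m + 3) s
          + (m + 3) * (∑ i, h i) / 2 * (bspline (m + 2) s + bspline (m + 2) (s - 1))
          - (m + 3) * (m + 2) / 2 * (∑ i, h i ^ 2) * bspline (m + 1) (s - 1)
          + C * (∑ i, h i) ^ 2))
      =o[𝓝 0] fun h => ‖h‖ ^ 2 := by
  have hS : ∀ S : Finset (Fin (m + 4)), (fun h : EuclideanSpace ℝ (Fin (m + 4)) =>
      truncPow (m + 3) (s + (∑ i, h i) / 2 - ∑ i ∈ S, (1 + h i)) -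
        (truncPow (m + 3) (s - S.card)
          + (m + 3) * truncPow (m + 2) (s - S.card) * ((∑ i, h i) / 2 - ∑ i ∈ S, h i)
          + (m + 3) * (m + 2) / 2 * truncPow (m + 1) (s - S.card)
            * ((∑ i, h i) / 2 - ∑ i ∈ S, h i) ^ 2)) =o[𝓝 0] fun h => ‖h‖ ^ 2 := by
    intro S
    have hu : (fun h : EuclideanSpace ℝ (Fin (m + 4)) => (∑ i, h i) / 2 - ∑ i ∈ S, h i)
        =O[𝓝 0] fun h => ‖h‖ := by
      simp only [div_eq_inv_mul]
      exact ((sum_isBigO_norm _).const_mul_left _).sub (sum_isBigO_norm S)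
    have ht : Tendsto (fun h : EuclideanSpace ℝ (Fin (m + 4)) =>
        (∑ i, h i) / 2 - ∑ i ∈ S, h i) (𝓝 0) (𝓝 0) := by
      have : Continuous (fun h : EuclideanSpace ℝ (Fin (m + 4)) =>
        (∑ i, h i) / 2 - ∑ i ∈ S, h i) := by fun_prop
      simpa using this.tendsto 0
    refine (((truncPow_taylor m (s - S.card)).comp_tendsto ht).trans_isBigO
      (hu.pow 2)).congr_left fun h => ?_
    simp only [Function.comp_apply, Finset.sum_add_distrib, Finset.sum_const, nsmul_eq_mul, mul_one]
    congr 2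
    ring
  have hsum := IsLittleO.fun_sum (s := (Finset.univ : Finset (Finset (Fin (m + 4)))))
    fun S _ => (hS S).const_mul_left ((-1 : ℝ) ^ S.card)
  refine ⟨(m + 3) * (m + 2) / 2 * (bwdDiff^[m + 2] (truncPow (m + 1)) (s - 2)
    + bwdDiff^[m + 3] (truncPow (m + 1)) (s - 1)
    + bwdDiff^[m + 4] (truncPow (m + 1)) s / 4), hsum.congr_left fun h => ?_⟩
  have a0 := sum_powerset_neg_one_pow (Finset.univ : Finset (Fin (m + 4)))
  have a1 := sum_powerset_neg_one_pow_mul_sum (Finset.univ : Finset (Fin (m + 4))) h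
  have a2 := sum_powerset_neg_one_pow_mul_sum_sq (Finset.univ : Finset (Fin (m + 4))) h
  simp only [Finset.powerset_univ, Finset.card_fin, show m + 4 - 1 = m + 3 by omega,
    show m + 4 - 2 = m + 2 by omega] at a0 a1 a2
  set e := ∑ i, h i
  set q := ∑ i, h i ^ 2
  have split : ∀ S : Finset (Fin (m + 4)), (-1 : ℝ) ^ S.card *
      (truncPow (m + 3) (s + e / 2 - ∑ i ∈ S, (1 + h i)) -
        (truncPow (m + 3) (s - S.card)
          + (m + 3) * truncPow (m + 2) (s - S.card) * (e / 2 - ∑ i ∈ S, h i)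
          + (m + 3) * (m + 2) / 2 * truncPow (m + 1) (s - S.card)
            * (e / 2 - ∑ i ∈ S, h i) ^ 2)) =
      (-1 : ℝ) ^ S.card * truncPow (m + 3) (s + e / 2 - ∑ i ∈ S, (1 + h i))
      - (-1 : ℝ) ^ S.card * truncPow (m + 3) (s - S.card)
      - (m + 3) * e / 2 * ((-1 : ℝ) ^ S.card * truncPow (m + 2) (s - S.card))
      + (m + 3) * ((-1 : ℝ) ^ S.card * truncPow (m + 2) (s - S.card) * ∑ i ∈ S, h i)
      - (m + 3) * (m + 2) / 8 * e ^ 2 * ((-1 : ℝ) ^ S.card * truncPow (m + 1) (s - S.card))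
      + (m + 3) * (m + 2) / 2 * e *
        ((-1 : ℝ) ^ S.card * truncPow (m + 1) (s - S.card) * ∑ i ∈ S, h i)
      - (m + 3) * (m + 2) / 2 *
        ((-1 : ℝ) ^ S.card * truncPow (m + 1) (s - S.card) * (∑ i ∈ S, h i) ^ 2) := by
    intro S; ring
  rw [Finset.sum_congr rfl fun S _ => split S]
  simp only [Finset.sum_sub_distrib, Finset.sum_add_distrib, ← Finset.mul_sum, a0, a1, a2]
  have b2 := bwdDiff_iterate_succ (m + 3) (truncPow (m + 2)) s
  have b1 := bwdDiff_iterate_succ (m + 2) (truncPow (m + 1)) (s - 1)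
  have b1' : s - 1 - 1 = s - 2 := by ring
  rw [b1'] at b1
  simp only [altSum, bspline]
  rw [show m + 3 + 1 = m + 4 by rfl, show m + 2 + 1 = m + 3 by rfl,
    show m + 1 + 1 = m + 2 by rfl] at *
  rw [b2, b1]
  simp only [Finset.sum_add_distrib]
  ring

/-- On the sphere `∑ (1 + h i) ^ 2 = m + 4`, the quotient `altSum / ∏ (1 + h i)`, to which the
section volume is proportional, has a strict local maximum at `h = 0`: there
`∑ h i = -‖h‖ ^ 2 / 2`, and the difference of the two sides is `A * ‖h‖ ^ 2 + o(‖h‖ ^ 2)` with the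
negative coefficient `A` of `bspline_combination_neg`. -/
lemma altSum_lt_prod_mul (m : ℕ) {s : ℝ} (hs : 0 < s) (hs' : s < (m + 3) / 4) :
    ∀ᶠ h : EuclideanSpace ℝ (Fin (m + 4)) in 𝓝 0, h ≠ 0 → 2 * ∑ i, h i = - ∑ i, h i ^ 2 →
      altSum (m + 3) (fun i => 1 + h i) (s + (∑ i, h i) / 2) <
        (∏ i, (1 + h i)) * bspline (m + 3) s := by
  obtain ⟨C, hC⟩ := altSum_expansion m s
  have hP := (prod_one_add_expansion (Finset.univ : Finset (Fin (m + 4)))).const_mul_left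
    (bspline (m + 3) s)
  have hA := bspline_combination_neg (m + 1) hs (by push_cast; linarith)
  have hb3 := bspline_succ (m + 2) s
  push_cast at hA hb3
  set A := (s - (m + 1 + 2) / 4) * bspline (m + 1 + 1) s
    + (m + 1 + 3 - s - (m + 1 + 2) / 4) * bspline (m + 1 + 1) (s - 1)
      - (m + 1 + 2) * (m + 1 + 1) / 2 * bspline (m + 1) (s - 1) with hAdef
  have hR := (hC.sub hP).def (c := -A / 4) (by linarith)
  set K := |C - bspline (m + 3) s / 2| with hK
  have hsmall : ∀ᶠ h : EuclideanSpace ℝ (Fin (m + 4)) in 𝓝 0, K * ‖h‖ ^ 2 < -A := by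
    have : Continuous fun h : EuclideanSpace ℝ (Fin (m + 4)) => K * ‖h‖ ^ 2 := by fun_prop
    refine this.tendsto 0 |>.eventually_lt_const ?_
    simpa using hA
  filter_upwards [hR, hsmall] with h h1 h2 hne hcon
  have hq : ‖h‖ ^ 2 = ∑ i, h i ^ 2 := by simp [EuclideanSpace.norm_sq_eq]
  have hpos : 0 < ‖h‖ ^ 2 := by positivity
  rw [Real.norm_of_nonneg hpos.le, Real.norm_eq_abs] at h1
  have h1' := (abs_le.1 h1).2
  rw [hq] at h1' h2 hpos
  set e := ∑ i, h i
  set q := ∑ i, h i ^ 2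
  have he : e = -q / 2 := by linarith
  -- Since `e = -q / 2`, the terms in `e ^ 2` are of fourth order.
  have hKe : (C - bspline (m + 3) s / 2) * e ^ 2 ≤ -A / 4 * q := by
    have : (C - bspline (m + 3) s / 2) * e ^ 2 ≤ K * e ^ 2 :=
      mul_le_mul_of_nonneg_right (le_abs_self _) (sq_nonneg _)
    rw [he] at this ⊢
    nlinarith
  have hAq : A * q = bspline (m + 3) s * q + (m + 3) * e / 2 * (bspline (m + 2) s
      + bspline (m + 2) (s - 1)) - (m + 3) * (m + 2) / 2 * q * bspline (m + 1) (s - 1) := by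
    rw [hAdef, he, hb3]
    ring
  rw [he] at h1' hKe hAq
  rw [he]
  nlinarith [mul_neg_of_neg_of_pos hA hpos]

/-! ### Volumes of slices of the cube -/

/-- The slice `{y ∈ [0,1]^k | ∑ i, β i * y i ≤ z}` of the cube. -/
def cubeSlice {k : ℕ} (β : Fin k → ℝ) (z : ℝ) : Set (Fin k → ℝ) :=
  {y | (∀ i, y i ∈ Icc (0 : ℝ) 1) ∧ ∑ i, β i * y i ≤ z}

lemma isClosed_setOf_forall_mem_Icc (k : ℕ) :
    IsClosed {y : Fin k → ℝ | ∀ i, y i ∈ Icc (0 : ℝ) 1} := by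
  have h : {y : Fin k → ℝ | ∀ i, y i ∈ Icc (0 : ℝ) 1} =
      ⋂ i, (fun y : Fin k → ℝ => y i) ⁻¹' Icc 0 1 := by ext y; simp
  rw [h]
  exact isClosed_iInter fun i => isClosed_Icc.preimage (continuous_apply i)

lemma measurableSet_cubeSlice {k : ℕ} (β : Fin k → ℝ) (z : ℝ) :
    MeasurableSet (cubeSlice β z) := by
  have hc : Continuous fun y : Fin k → ℝ => ∑ i, β i * y i := by fun_prop
  exact ((isClosed_setOf_forall_mem_Icc k).inter (isClosed_le hc continuous_const)).measurableSet

/-- Splitting the vertices of the cube according to their first coordinate. -/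
lemma altSum_succ {k : ℕ} (n : ℕ) (β : Fin (k + 1) → ℝ) (z : ℝ) :
    altSum n β z = altSum n (fun i => β i.succ) z - altSum n (fun i => β i.succ) (z - β 0) := by
  have hmap : ∀ F : Finset (Fin (k + 1)) → ℝ,
      ∑ S ∈ ((Finset.univ : Finset (Fin k)).map (Fin.succEmb k)).powerset, F S =
        ∑ S : Finset (Fin k), F (S.map (Fin.succEmb k)) := by
    intro F
    have : ((Finset.univ : Finset (Fin k)).map (Fin.succEmb k)).powerset =
        (Finset.univ : Finset (Finset (Fin k))).map
          (Finset.mapEmbedding (Fin.succEmb k)).toEmbedding := by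
      ext S
      simp [Finset.subset_map_iff, eq_comm]
    rw [this, Finset.sum_map]
    rfl
  have hnot : ∀ S : Finset (Fin k), (0 : Fin (k + 1)) ∉ S.map (Fin.succEmb k) := by
    intro S; simp
  have huniv : (Finset.univ : Finset (Fin (k + 1))) =
      insert 0 ((Finset.univ : Finset (Fin k)).map (Fin.succEmb k)) := by
    rw [Fin.univ_succ, Finset.cons_eq_insert]; rfl
  rw [altSum, ← Finset.powerset_univ, huniv, Finset.sum_powerset_insert (hnot _), hmap, hmap,
    sub_eq_add_neg, altSum, altSum, ← Finset.sum_neg_distrib]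
  congr 1
  · simp
  · refine Finset.sum_congr rfl fun S _ => ?_
    rw [Finset.card_insert_of_notMem (hnot S), Finset.sum_insert (hnot S)]
    simp [pow_succ, sub_sub]

lemma monotone_truncPow (n : ℕ) : Monotone (truncPow n) := by
  intro x y hxy
  rcases lt_or_ge x 0 with h | h
  · rw [truncPow_of_neg h, truncPow]
    split_ifs with hy
    · positivity
    · exact le_rfl
  · rw [truncPow_of_nonneg h, truncPow_of_nonneg (h.trans hxy)]
    gcongr

lemma intervalIntegrable_truncPow (n : ℕ) {b : ℝ} (hb : 0 < b) (z c d : ℝ) :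
    IntervalIntegrable (fun y => truncPow n (z - b * y)) volume c d := by
  refine Antitone.intervalIntegrable fun x y hxy => monotone_truncPow n ?_
  nlinarith

lemma integral_truncPow (n : ℕ) {b : ℝ} (hb : 0 < b) (z : ℝ) :
    (n + 1) * b * ∫ y in (0 : ℝ)..1, truncPow n (z - b * y) =
      truncPow (n + 1) z - truncPow (n + 1) (z - b) := by
  have hn : (0 : ℝ) < n + 1 := by positivity
  have := integral_eq_of_hasDerivAt_off_countable_of_le
    (fun y => - truncPow (n + 1) (z - b * y) / ((n + 1) * b)) (fun y => truncPow n (z - b * y))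
    (zero_le_one' ℝ) (countable_singleton (z / b)) ?_ ?_ (intervalIntegrable_truncPow n hb z 0 1)
  · rw [this]
    simp only [mul_one, mul_zero, sub_zero]
    field_simp
    ring
  · have := continuous_truncPow n
    exact Continuous.continuousOn (by fun_prop)
  · rintro y ⟨-, hy⟩
    have hne : z - b * y ≠ 0 := by
      intro h
      refine hy (mem_singleton_iff.2 ?_)
      field_simp
      linarith
    have h1 : HasDerivAt (fun y => z - b * y) (-b) y := by
      simpa using ((hasDerivAt_id y).const_mul b).const_sub z
    refine (((hasDerivAt_truncPow_of_ne n hne).comp y h1).neg.div_const _).congr_deriv ?_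
    field_simp

lemma integral_altSum {k : ℕ} (n : ℕ) (β : Fin (k + 1) → ℝ) (hβ : 0 < β 0) (z : ℝ) :
    (n + 1) * β 0 * ∫ y in (0 : ℝ)..1, altSum n (fun i => β i.succ) (z - β 0 * y) =
      altSum (n + 1) β z := by
  have hterm : ∀ S : Finset (Fin k), ∀ y, truncPow n (z - β 0 * y - ∑ i ∈ S, β i.succ) =
      truncPow n (z - ∑ i ∈ S, β i.succ - β 0 * y) := fun S y => by rw [sub_right_comm]
  rw [altSum_succ]
  simp only [altSum, hterm]
  rw [intervalIntegral.integral_finsetSum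
    fun S _ => (intervalIntegrable_truncPow n hβ _ 0 1).const_mul _, Finset.mul_sum,
    ← Finset.sum_sub_distrib]
  refine Finset.sum_congr rfl fun S _ => ?_
  rw [intervalIntegral.integral_const_mul, mul_left_comm, integral_truncPow n hβ, mul_sub,
    sub_right_comm z (β 0)]

lemma intervalIntegrable_altSum {k : ℕ} (n : ℕ) (β : Fin (k + 1) → ℝ) (hβ : 0 < β 0) (z : ℝ) :
    IntervalIntegrable (fun y => altSum n (fun i => β i.succ) (z - β 0 * y)) volume 0 1 := by
  have hterm : ∀ S : Finset (Fin k), ∀ y, truncPow n (z - β 0 * y - ∑ i ∈ S, β i.succ) =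
      truncPow n (z - ∑ i ∈ S, β i.succ - β 0 * y) := fun S y => by rw [sub_right_comm]
  simp only [altSum, hterm]
  have := IntervalIntegrable.sum (μ := volume) (a := (0 : ℝ)) (b := 1) Finset.univ
    (f := fun (S : Finset (Fin k)) y =>
      (-1 : ℝ) ^ S.card * truncPow n (z - ∑ i ∈ S, β i.succ - β 0 * y))
    fun S _ => (intervalIntegrable_truncPow n hβ _ 0 1).const_mul _
  convert! this using 1
  ext y
  simp

lemma mem_cubeSlice_cons {k : ℕ} (β : Fin (k + 1) → ℝ) (z x : ℝ) (y : Fin k → ℝ) :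
    Fin.cons x y ∈ cubeSlice β z ↔
      x ∈ Icc (0 : ℝ) 1 ∧ y ∈ cubeSlice (fun i => β i.succ) (z - β 0 * x) := by
  simp only [cubeSlice, mem_ofPred_eq, Fin.forall_fin_succ, Fin.cons_zero, Fin.cons_succ,
    Fin.sum_univ_succ, le_sub_iff_add_le']
  tauto

/-- The volume of a slice of the cube as an alternating sum over the vertices. -/
lemma volume_cubeSlice {n : ℕ} (β : Fin n → ℝ) (hβ : ∀ i, 0 < β i) (z : ℝ) :
    0 ≤ altSum n β z ∧
      volume (cubeSlice β z) = ENNReal.ofReal (altSum n β z / (n.factorial * ∏ i, β i)) := by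
  induction n generalizing z with
  | zero =>
    have h0 : altSum 0 β z = truncPow 0 z := by
      rw [altSum, Fintype.sum_unique, show (default : Finset (Fin 0)) = ∅ from rfl]
      simp
    rw [h0]
    rcases lt_or_ge z 0 with h | h
    · have : cubeSlice β z = ∅ := by
        ext y; simp [cubeSlice, h]
      rw [truncPow_of_neg h, this]; simp
    · have : cubeSlice β z = univ := by
        ext y; simp [cubeSlice, h]
      rw [truncPow_of_nonneg h, this, volume_pi, Measure.pi_of_empty _ 0]; simp
  | succ n ih =>
    have ih' := ih (fun i => β i.succ) fun i => hβ _
    have hint := integral_altSum n β (hβ 0) z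
    have hnn : 0 ≤ ∫ y in (0 : ℝ)..1, altSum n (fun i => β i.succ) (z - β 0 * y) :=
      intervalIntegral.integral_nonneg zero_le_one fun y _ => (ih' _).1
    refine ⟨?_, ?_⟩
    · rw [← hint]
      have := hβ 0
      positivity
    have hmp := (volume_preserving_piFinSuccAbove (fun _ : Fin (n + 1) => ℝ) 0).symm
    rw [← hmp.measure_preimage (measurableSet_cubeSlice β z).nullMeasurableSet]
    have hms := (measurableSet_cubeSlice β z).preimage hmp.measurable
    change (volume.prod volume) _ = _
    rw [Measure.prod_apply hms]
    have hfib : ∀ x : ℝ, volume (Prod.mk x ⁻¹'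
        ((MeasurableEquiv.piFinSuccAbove (fun _ : Fin (n + 1) => ℝ) 0).symm ⁻¹' cubeSlice β z)) =
        (Icc (0 : ℝ) 1).indicator (fun x => ENNReal.ofReal
          (altSum n (fun i => β i.succ) (z - β 0 * x) /
            (n.factorial * ∏ i : Fin n, β i.succ))) x := by
      intro x
      have hset : (Prod.mk x ⁻¹'
          ((MeasurableEquiv.piFinSuccAbove (fun _ : Fin (n + 1) => ℝ) 0).symm ⁻¹'
            cubeSlice β z)) = {y | x ∈ Icc (0 : ℝ) 1 ∧
              y ∈ cubeSlice (fun i => β i.succ) (z - β 0 * x)} := by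
        ext y
        rw [mem_ofPred_eq, ← mem_cubeSlice_cons]
        rw [mem_preimage, mem_preimage, MeasurableEquiv.piFinSuccAbove_symm_apply,
          Fin.insertNthEquiv_zero]
        rfl
      rw [hset]
      by_cases hx : x ∈ Icc (0 : ℝ) 1
      · rw [indicator_of_mem hx, ← (ih' _).2]
        congr 1
        ext y
        simp only [mem_ofPred_eq, hx, true_and]
      · rw [indicator_of_notMem hx]
        simp [hx]
    simp_rw [hfib]
    rw [lintegral_indicator measurableSet_Icc,
      Measure.restrict_congr_set Ioc_ae_eq_Icc.symm]
    have hI := ((intervalIntegrable_altSum n β (hβ 0) z).1).div_const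
      (n.factorial * ∏ i : Fin n, β i.succ)
    have hP : 0 < ∏ i : Fin n, β i.succ := Finset.prod_pos fun i _ => hβ _
    rw [← ofReal_integral_eq_lintegral_ofReal hI
      (Eventually.of_forall fun x => div_nonneg (ih' _).1 (by positivity)),
      integral_div, ← intervalIntegral.integral_of_le zero_le_one, ← hint, Fin.prod_univ_succ,
      Nat.factorial_succ]
    congr 1
    have := (hβ 0).ne'
    push_cast
    field_simp

/-! ### Volumes of hyperplane sections -/

/-- A hyperplane of `ℝᵏ` is a null set. -/
lemma volume_hyperplane {k : ℕ} (β : Fin (k + 1) → ℝ) (hβ : β 0 ≠ 0) (z : ℝ) :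
    volume {y : Fin (k + 1) → ℝ | ∑ i, β i * y i = z} = 0 := by
  let f : (Fin (k + 1) → ℝ) →ₗ[ℝ] ℝ := ∑ i, β i • LinearMap.proj i
  have hf : ∀ y, f y = ∑ i, β i * y i := fun y => by simp [f]
  have hp : f (Pi.single 0 (-(z / β 0))) = -z := by
    rw [hf, Finset.sum_eq_single 0 (fun i _ hi => by simp [hi]) (by simp)]
    simp only [Pi.single_eq_same]
    field_simp
  have hker : LinearMap.ker f ≠ ⊤ := by
    intro h
    have h1 : Pi.single 0 1 ∈ LinearMap.ker f := h ▸ Submodule.mem_top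
    rw [LinearMap.mem_ker, hf, Finset.sum_eq_single 0 (fun i _ hi => by simp [hi]) (by simp)] at h1
    simp [hβ] at h1
  have hset : {y : Fin (k + 1) → ℝ | ∑ i, β i * y i = z} =
      (fun y => y + Pi.single 0 (-(z / β 0))) ⁻¹' (LinearMap.ker f : Set (Fin (k + 1) → ℝ)) := by
    ext y
    rw [mem_preimage, SetLike.mem_coe, LinearMap.mem_ker, map_add, hp, hf]
    simp [← sub_eq_add_neg, sub_eq_zero]
  rw [hset, measure_preimage_add_right]
  exact Measure.addHaar_submodule _ _ hker

/-- The linear map whose graph over the last `n` coordinates is `{x | ∑ i, β i * x i = 0}`. -/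
noncomputable def graphMap {n : ℕ} (β : Fin (n + 1) → ℝ) :
    EuclideanSpace ℝ (Fin n) →ₗ[ℝ] EuclideanSpace ℝ (Fin (n + 1)) where
  toFun y := WithLp.toLp 2 (Fin.cons (-(∑ i, β i.succ * y i) / β 0) y)
  map_add' y y' := by
    ext i
    refine Fin.cases ?_ (fun j => ?_) i
    · simp [mul_add, Finset.sum_add_distrib]; ring
    · simp
  map_smul' c y := by
    ext i
    refine Fin.cases ?_ (fun j => ?_) i
    · simp only [PiLp.smul_apply, smul_eq_mul, RingHom.id_apply, Fin.cons_zero,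
        mul_left_comm _ c, ← Finset.mul_sum]
      ring
    · simp

lemma graphMap_apply {n : ℕ} (β : Fin (n + 1) → ℝ) (y : EuclideanSpace ℝ (Fin n)) :
    graphMap β y = WithLp.toLp 2 (Fin.cons (-(∑ i, β i.succ * y i) / β 0) y) := rfl

/-- The factor by which `graphMap β` scales volumes, from the determinant of `1 + u uᵀ` with
`u i = β (i + 1) / β 0`. -/
lemma normDet_graphMap {n : ℕ} (β : Fin (n + 1) → ℝ) (hβ : 0 < β 0) :
    (graphMap β).normDet = √(∑ i, β i ^ 2) / β 0 := by
  have h := LinearMap.normDet_sq_eq_det_gram (graphMap β) (EuclideanSpace.basisFun (Fin n) ℝ)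
  have hM : Matrix.gram ℝ (fun i => graphMap β (EuclideanSpace.basisFun (Fin n) ℝ i)) =
      1 + Matrix.replicateCol Unit (fun i : Fin n => β i.succ / β 0) *
        Matrix.replicateRow Unit (fun i : Fin n => β i.succ / β 0) := by
    ext i j
    have hs : ∀ i : Fin n, ∑ l, β l.succ * (EuclideanSpace.single i (1 : ℝ)) l = β i.succ := by
      intro i
      simp
    simp only [Matrix.gram_apply, EuclideanSpace.basisFun_apply, graphMap_apply, hs,
      PiLp.inner_apply, Fin.sum_univ_succ, Fin.cons_zero, Fin.cons_succ, Matrix.add_apply,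
      Matrix.mul_apply, Matrix.replicateCol_apply, Matrix.replicateRow_apply, Matrix.one_apply]
    simp [eq_comm]
    ring
  rw [hM, Matrix.det_one_add_replicateCol_mul_replicateRow] at h
  have h2 : (graphMap β).normDet ^ 2 = (∑ i, β i ^ 2) / β 0 ^ 2 := by
    have h' : (graphMap β).normDet ^ 2 = 1 + (fun i : Fin n => β i.succ / β 0) ⬝ᵥ
      fun i : Fin n => β i.succ / β 0 := h
    rw [h', Fin.sum_univ_succ, dotProduct, add_div, Finset.sum_div, div_self (by positivity)]
    congr 1
    exact Finset.sum_congr rfl fun i _ => by ring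
  rw [← Real.sqrt_sq (graphMap β).normDet_nonneg, h2, Real.sqrt_div' _ (by positivity),
    Real.sqrt_sq hβ.le]

/-- The volume of a hyperplane section of the cube, for a normal vector with positive entries.
The section is a graph over its projection to the last coordinates, and the projection is a
difference of two slices. -/
lemma euclideanHausdorffMeasure_cubeSection {n : ℕ} (β : Fin (n + 2) → ℝ) (hβ : ∀ i, 0 < β i)
    (z : ℝ) :
    μHE[n + 1] ({x : EuclideanSpace ℝ (Fin (n + 2)) | ∑ i, β i * x i = z} ∩ unitCube (n + 2)) =
      ENNReal.ofReal (√(∑ i, β i ^ 2) * altSum (n + 1) β z /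
        ((n + 1).factorial * ∏ i, β i)) := by
  have h0 := hβ 0
  set γ : Fin (n + 1) → ℝ := fun i => β i.succ with hγ
  have hγpos : ∀ i, 0 < γ i := fun i => hβ _
  -- The projection of the section to the last `n + 1` coordinates; the face `x 0 = 1` is added
  -- back as a separate null set.
  set B : Set (Fin (n + 1) → ℝ) := cubeSlice γ z \ cubeSlice γ (z - β 0) ∪
    {y | (∀ i, y i ∈ Icc (0 : ℝ) 1) ∧ ∑ i, γ i * y i = z - β 0} with hB
  have hmem : ∀ y : Fin (n + 1) → ℝ, y ∈ B ↔ (∀ i, y i ∈ Icc (0 : ℝ) 1) ∧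
      (z - ∑ i, γ i * y i) / β 0 ∈ Icc (0 : ℝ) 1 := by
    intro y
    simp only [hB, cubeSlice, mem_union, Set.mem_sdiff, mem_ofPred_eq,
      mem_Icc (a := (0 : ℝ)) (x := _ / _), div_le_one h0, le_div_iff₀ h0, zero_mul]
    constructor
    · rintro (⟨⟨h1, h2⟩, h3⟩ | ⟨h1, h2⟩)
      · refine ⟨h1, by linarith, ?_⟩
        by_contra h4
        exact h3 ⟨h1, by linarith⟩
      · exact ⟨h1, by linarith, by linarith⟩
    · rintro ⟨h1, h2, h3⟩
      rcases eq_or_ne (∑ i, γ i * y i) (z - β 0) with h4 | h4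
      · exact Or.inr ⟨h1, h4⟩
      · exact Or.inl ⟨⟨h1, by linarith⟩, fun h5 => h4 (le_antisymm h5.2 (by linarith))⟩
  have himage : {x : EuclideanSpace ℝ (Fin (n + 2)) | ∑ i, β i * x i = z} ∩ unitCube (n + 2) =
      (fun x => x + EuclideanSpace.single 0 (z / β 0)) '' (graphMap β '' (WithLp.ofLp ⁻¹' B)) := by
    ext x
    simp only [mem_inter_iff, mem_ofPred_eq, image_image, mem_image, mem_preimage, hmem, unitCube]
    have hcoord : ∀ y : EuclideanSpace ℝ (Fin (n + 1)),
        graphMap β y + EuclideanSpace.single 0 (z / β 0) =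
          WithLp.toLp 2 (Fin.cons ((z - ∑ i, γ i * y i) / β 0) y) := by
      intro y
      ext i
      refine Fin.cases ?_ (fun j => ?_) i
      · simp [graphMap_apply, hγ]; ring
      · simp [graphMap_apply]
    simp only [hcoord]
    constructor
    · rintro ⟨h1, h2⟩
      rw [Fin.sum_univ_succ] at h1
      have h3 : (z - ∑ i, γ i * x i.succ) / β 0 = x 0 := by
        rw [← h1, hγ]; field_simp; ring
      refine ⟨WithLp.toLp 2 fun i => x i.succ, ⟨fun i => h2 _, ?_⟩, ?_⟩
      · simpa only [h3] using h2 0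
      · ext i
        refine Fin.cases ?_ (fun j => ?_) i
        · simpa using h3
        · simp
    · rintro ⟨y, ⟨h1, h2⟩, rfl⟩
      refine ⟨?_, fun i => Fin.cases ?_ (fun j => ?_) i⟩
      · simp only [Fin.sum_univ_succ (n := n + 1), Fin.cons_zero, Fin.cons_succ, hγ]
        field_simp
        ring
      · simpa using h2
      · simpa using h1 j
  have hvol : volume B = ENNReal.ofReal (altSum (n + 1) β z /
      ((n + 1).factorial * ∏ i, γ i)) := by
    have hnull : volume {y : Fin (n + 1) → ℝ | (∀ i, y i ∈ Icc (0 : ℝ) 1) ∧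
        ∑ i, γ i * y i = z - β 0} = 0 :=
      measure_mono_null (fun y hy => hy.2) (volume_hyperplane γ (hγpos 0).ne' (z - β 0))
    have hsub : cubeSlice γ (z - β 0) ⊆ cubeSlice γ z :=
      fun y hy => ⟨hy.1, hy.2.trans (by linarith)⟩
    rw [hB, measure_congr (union_ae_eq_left_of_ae_eq_empty (ae_eq_empty.2 hnull)), measure_sdiff hsub
      (measurableSet_cubeSlice _ _).nullMeasurableSet
      (by rw [(volume_cubeSlice γ hγpos _).2]; exact ENNReal.ofReal_ne_top),
      (volume_cubeSlice γ hγpos _).2, (volume_cubeSlice γ hγpos _).2,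
      ← ENNReal.ofReal_sub _ (div_nonneg (volume_cubeSlice γ hγpos (z - β 0)).1
        (mul_nonneg (by positivity) (Finset.prod_nonneg fun i _ => (hγpos i).le))),
      altSum_succ (n + 1) β, sub_div]
  have hscale := (graphMap β).euclideanHausdorffMeasure_image_eq_normDet_mul_volume
    (WithLp.ofLp ⁻¹' B)
  rw [finrank_euclideanSpace_fin, normDet_graphMap β h0] at hscale
  have hms : MeasurableSet B := by
    have hset : B = {y | (∀ i, y i ∈ Icc (0 : ℝ) 1)} ∩
        (fun y : Fin (n + 1) → ℝ => (z - ∑ i, γ i * y i) / β 0) ⁻¹' Icc 0 1 := by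
      ext y; rw [hmem]; rfl
    have hc : Continuous fun y : Fin (n + 1) → ℝ => (z - ∑ i, γ i * y i) / β 0 := by fun_prop
    rw [hset]
    exact ((isClosed_setOf_forall_mem_Icc _).inter (isClosed_Icc.preimage hc)).measurableSet
  rw [himage, (isometry_add_right _).euclideanHausdorffMeasure_image, hscale,
    (PiLp.volume_preserving_ofLp (Fin (n + 1))).measure_preimage hms.nullMeasurableSet, hvol,
    ← ENNReal.ofReal_mul (by positivity), Fin.prod_univ_succ β]
  congr 1
  have : 0 < ∏ i : Fin (n + 1), γ i := Finset.prod_pos fun i _ => hγpos i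
  simp only [hγ] at this ⊢
  field_simp

/-! ### The local maximum -/

/-- The section of the cube by a hyperplane does not change when normal vector and cube are
reflected in coordinate hyperplanes through the center, so only the `|b i|` matter; the reflection
used here moves the vertex of the cube cut off by the hyperplane to the origin. The free factor `c`
rescales the equation of the hyperplane. -/
lemma sectionVolume_eq_of_ne_zero {d : ℕ} (t : ℝ) (b : EuclideanSpace ℝ (Fin d))
    (hb : ∀ i, b i ≠ 0) {c : ℝ} (hc : 0 < c) :
    sectionVolume d t b = μHE[d - 1] ({x : EuclideanSpace ℝ (Fin d) |
      ∑ i, c * |b i| * x i = (∑ i, c * |b i|) / 2 - c * t} ∩ unitCube d) := by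
  classical
  set φ : EuclideanSpace ℝ (Fin d) → EuclideanSpace ℝ (Fin d) := fun x =>
    WithLp.toLp 2 fun i => if 0 < b i then 1 - x i else x i with hφ
  have hφi : ∀ x i, φ x i = if 0 < b i then 1 - x i else x i := fun x i => rfl
  have hiso : Isometry φ := by
    refine Isometry.of_dist_eq fun x y => ?_
    rw [EuclideanSpace.dist_eq, EuclideanSpace.dist_eq]
    congr 1
    refine Finset.sum_congr rfl fun i _ => ?_
    rw [hφi, hφi]
    split_ifs
    · rw [dist_sub_left]
    · rfl
  have hinv : Function.Involutive φ := by
    intro x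
    ext i
    rw [hφi, hφi]
    split_ifs <;> ring
  have hplane : ∀ x, φ x ∈ tangentHyperplane d t b ↔
      ∑ i, c * |b i| * x i = (∑ i, c * |b i|) / 2 - c * t := by
    intro x
    have hterm : ∀ i, (φ x i - 1 / 2) * b i = |b i| / 2 - |b i| * x i := by
      intro i
      rw [hφi]
      split_ifs with h
      · rw [abs_of_pos h]; ring
      · rw [abs_of_neg (lt_of_le_of_ne (not_lt.1 h) (hb i))]; ring
    have hin : inner ℝ b (φ x - cubeCenter d) = (∑ i, |b i|) / 2 - ∑ i, |b i| * x i := by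
      rw [PiLp.inner_apply, Finset.sum_div, ← Finset.sum_sub_distrib]
      exact Finset.sum_congr rfl fun i _ => hterm i
    simp only [tangentHyperplane, mem_ofPred_eq, hin, mul_assoc, ← Finset.mul_sum]
    constructor
    · intro h; rw [← h]; ring
    · intro h
      refine mul_left_cancel₀ hc.ne' ?_
      linarith
  have hcube : ∀ x, φ x ∈ unitCube d ↔ x ∈ unitCube d := by
    intro x
    refine forall_congr' fun i => ?_
    rw [hφi]
    split_ifs
    · simp only [mem_Icc]
      constructor <;> rintro ⟨h1, h2⟩ <;> constructor <;> linarith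
    · rfl
  rw [sectionVolume, ← hiso.euclideanHausdorffMeasure_image]
  congr 1
  ext x
  rw [hinv.image_eq_preimage_symm]
  simp only [mem_inter_iff, mem_preimage, hcube, mem_ofPred_eq]
  rw [← hplane]

/-- A unit normal of a hyperplane orthogonal to a diagonal has entries `±1/√d`. -/
lemma sq_apply_of_isOrthogonalToDiagonal {d : ℕ} {t : ℝ} {a : EuclideanSpace ℝ (Fin d)}
    (ha : a ∈ Metric.sphere (0 : EuclideanSpace ℝ (Fin d)) 1)
    (h : IsOrthogonalToDiagonal d (tangentHyperplane d t a)) (i : Fin d) :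
    d * a i ^ 2 = 1 := by
  obtain ⟨v, w, hvw, horth⟩ := h
  have hna : ‖a‖ = 1 := by simpa using ha
  have haa : inner ℝ a a = (1 : ℝ) := by rw [real_inner_self_eq_norm_sq, hna]; norm_num
  set e := w - v with he
  set l : ℝ := inner ℝ a e with hl
  set u := e - l • a with hu
  have hua : inner ℝ a u = (0 : ℝ) := by
    rw [hu, inner_sub_right, inner_smul_right, haa, ← hl]; ring
  have hx : cubeCenter d + t • a ∈ tangentHyperplane d t a := by
    simp [tangentHyperplane, inner_smul_right, hna]
  have hy : cubeCenter d + t • a + u ∈ tangentHyperplane d t a := by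
    have : cubeCenter d + t • a + u - cubeCenter d = t • a + u := by abel
    simp [tangentHyperplane, this, inner_add_right, inner_smul_right, hua, hna]
  have heu : inner ℝ e u = (0 : ℝ) := by simpa using horth _ hx _ hy
  have hu0 : u = 0 := by
    rw [← inner_self_eq_zero (𝕜 := ℝ)]
    nth_rewrite 1 [hu]
    rw [inner_sub_left, inner_smul_left, heu, hua]
    simp
  have hel : e = l • a := sub_eq_zero.1 hu0
  have hei : ∀ j, e j ^ 2 = 1 := by
    intro j
    rcases hvw j with ⟨h1, h2⟩ | ⟨h1, h2⟩ <;> simp [he, h1, h2]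
  have hl2 : l ^ 2 = d := by
    have h1 : ‖e‖ ^ 2 = d := by
      simp only [EuclideanSpace.norm_sq_eq, Real.norm_eq_abs, sq_abs, hei]
      simp
    rw [hel, norm_smul, hna, mul_one, Real.norm_eq_abs, sq_abs] at h1
    exact h1
  rw [← hl2, ← hei i, hel]
  simp [mul_pow]

/-- The volume of the section with unit normal `b`, in terms of the deviation `h` of the rescaled
normal `√d * |b|` from the all-ones vector; `h` satisfies the equation of the rescaled sphere. -/
lemma sectionVolume_formula {m : ℕ} (t : ℝ) (b : EuclideanSpace ℝ (Fin (m + 4)))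
    (hb : ∀ i, b i ≠ 0) (hb1 : ‖b‖ = 1) {h : EuclideanSpace ℝ (Fin (m + 4))}
    (hh : ∀ i, 1 + h i = √(m + 4) * |b i|) :
    2 * ∑ i, h i = - ∑ i, h i ^ 2 ∧ sectionVolume (m + 4) t b = ENNReal.ofReal (√(m + 4) *
      altSum (m + 3) (fun i => 1 + h i) ((m + 4) / 2 - √(m + 4) * t + (∑ i, h i) / 2) /
      ((m + 3).factorial * ∏ i, (1 + h i))) := by
  have hd : (0 : ℝ) < √(m + 4) := by positivity
  have hsq : ∑ i, (1 + h i) ^ 2 = (m : ℝ) + 4 := by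
    have h1 : ∑ i, b i ^ 2 = (1 : ℝ) := by
      have := EuclideanSpace.norm_sq_eq b
      simpa [hb1, eq_comm] using this
    simp only [hh, mul_pow, sq_abs, ← Finset.mul_sum, h1]
    rw [Real.sq_sqrt (by positivity), mul_one]
  have hsum : ∑ i, (1 + h i) = (m : ℝ) + 4 + ∑ i, h i := by
    simp [Finset.sum_add_distrib]
  refine ⟨?_, ?_⟩
  · have : ∑ i, (1 + h i) ^ 2 = ((m : ℝ) + 4) + 2 * ∑ i, h i + ∑ i, h i ^ 2 := by
      simp only [add_sq, Finset.sum_add_distrib, Finset.mul_sum]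
      simp
    linarith
  · rw [sectionVolume_eq_of_ne_zero t b hb hd]
    simp only [← hh]
    have := euclideanHausdorffMeasure_cubeSection (fun i => 1 + h i)
      (fun i => by rw [hh]; have := abs_pos.2 (hb i); positivity)
      ((∑ i, (1 + h i)) / 2 - √(m + 4) * t)
    rw [hsq] at this
    refine this.trans ?_
    rw [hsum]
    congr 5
    ring

/-- With `s = d / 2 - √d * t`, the hypotheses on `t` say that `0 < s < (d - 1) / 4`. -/
lemma isStrictLocalMaxOn_sectionVolume {d : ℕ} {t : ℝ} (hd : 4 ≤ d)
    (ht : √(d : ℝ) / 2 - (d - 1) / 4 / √d < t) (ht' : t < √(d : ℝ) / 2)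
    {a : EuclideanSpace ℝ (Fin d)} (ha : a ∈ Metric.sphere (0 : EuclideanSpace ℝ (Fin d)) 1)
    (had : IsOrthogonalToDiagonal d (tangentHyperplane d t a)) :
    IsStrictLocalMaxOn (sectionVolume d t) (Metric.sphere 0 1) a := by
  have hai := sq_apply_of_isOrthogonalToDiagonal ha had
  obtain ⟨m, rfl⟩ := Nat.exists_eq_add_of_le' hd
  push_cast at ht ht' hai
  have hdpos : (0 : ℝ) < √(m + 4) := by positivity
  have hdsq : √((m : ℝ) + 4) * √(m + 4) = m + 4 := Real.mul_self_sqrt (by positivity)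
  set s : ℝ := (m + 4) / 2 - √(m + 4) * t with hs
  have hs0 : 0 < s := by
    have := mul_lt_mul_of_pos_left ht' hdpos
    rw [hs]; linarith
  have hs1 : s < (m + 3) / 4 := by
    have := mul_lt_mul_of_pos_left ht hdpos
    rw [mul_sub, mul_div_cancel₀ _ hdpos.ne'] at this
    rw [hs]; linarith
  have ha0 : ∀ i, a i ≠ 0 := fun i h => by simpa [h] using hai i
  have haabs : ∀ i, √((m : ℝ) + 4) * |a i| = 1 := by
    intro i
    rw [← Real.sqrt_sq_eq_abs, ← Real.sqrt_mul (by positivity), hai i, Real.sqrt_one]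
  set H : EuclideanSpace ℝ (Fin (m + 4)) → EuclideanSpace ℝ (Fin (m + 4)) := fun b =>
    WithLp.toLp 2 fun i => √(m + 4) * |b i| - 1 with hH
  have hHi : ∀ b i, 1 + H b i = √(m + 4) * |b i| := fun b i => by simp [hH]
  have hHa : H a = 0 := by ext i; simp [hH, haabs]
  have hHc : Tendsto H (𝓝 a) (𝓝 0) := by
    have : Continuous H := by fun_prop
    simpa [hHa] using this.tendsto a
  have hsign : ∀ᶠ b : EuclideanSpace ℝ (Fin (m + 4)) in 𝓝 a, ∀ i, 0 < a i * b i := by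
    refine eventually_all.2 fun i => ?_
    have : Continuous fun b : EuclideanSpace ℝ (Fin (m + 4)) => a i * b i := by fun_prop
    exact (this.tendsto a).eventually_const_lt (mul_self_pos.2 (ha0 i))
  have hlt := hHc.eventually (altSum_lt_prod_mul m hs0 hs1)
  have hmain : ∀ᶠ b in 𝓝 a, b ∈ Metric.sphere (0 : EuclideanSpace ℝ (Fin (m + 4))) 1 \ {a} →
      sectionVolume (m + 4) t b < sectionVolume (m + 4) t a := by
    filter_upwards [hlt, hsign] with b hb hsb hmem
    have hb1 : ‖b‖ = 1 := by simpa using hmem.1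
    have ha1 : ‖a‖ = 1 := by simpa using ha
    have hb0 : ∀ i, b i ≠ 0 := fun i h => by simpa [h] using hsb i
    have hHb : H b ≠ 0 := by
      intro h0
      refine hmem.2 ?_
      rw [mem_singleton_iff]
      ext i
      have h1 : |b i| = |a i| := by
        have := hHi b i
        rw [h0] at this
        refine mul_left_cancel₀ hdpos.ne' ?_
        rw [← this, haabs]; simp
      rcases abs_eq_abs.1 h1 with h2 | h2
      · exact h2
      · have := hsb i
        rw [h2] at this
        nlinarith [mul_self_nonneg (a i)]
    obtain ⟨hcon, hVb⟩ := sectionVolume_formula t b hb0 hb1 (hHi b)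
    obtain ⟨-, hVa⟩ := sectionVolume_formula t a ha0 ha1 (hHi a)
    have hlt' := hb hHb hcon
    have hprod : 0 < ∏ i, (1 + H b i) := Finset.prod_pos fun i _ => by
      rw [hHi]
      have := abs_pos.2 (hb0 i)
      positivity
    have hbs : 0 < bspline (m + 3) s :=
      bspline_pos _ hs0 (by push_cast; linarith [m.cast_nonneg (α := ℝ)])
    rw [hVa, hVb, hHa, ← hs]
    simp only [PiLp.zero_apply, add_zero, Finset.sum_const_zero, zero_div, Finset.prod_const_one,
      mul_one]
    rw [altSum_one]
    refine (ENNReal.ofReal_lt_ofReal_iff (by positivity)).2 ?_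
    rw [div_lt_div_iff₀ (by positivity) (by positivity)]
    have := mul_lt_mul_of_pos_left hlt'
      (by positivity : (0 : ℝ) < √(m + 4) * (m + 3).factorial)
    linarith
  rw [IsStrictLocalMaxOn, eventually_nhdsWithin_iff]
  exact hmain

/-! ### Asymptotics of the range -/

/-- With `u = log x / (x - 3)`, the quotient is `(x - 3) / x * e ^ u / ((e ^ u - 1) / u)`, and
`u → 0`. -/
lemma tendsto_log_div_mul_rpow :
    Tendsto (fun x : ℝ => Real.log x / x * (x ^ (1 / (x - 3)) / (x ^ (1 / (x - 3)) - 1)))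
      atTop (𝓝 1) := by
  have hu : Tendsto (fun x : ℝ => Real.log x / (x - 3)) atTop (𝓝 0) := by
    simpa [sub_eq_add_neg] using Real.tendsto_pow_log_div_mul_add_atTop 1 (-3) 1 one_ne_zero
  have hu' : Tendsto (fun x : ℝ => Real.log x / (x - 3)) atTop (𝓝[≠] 0) := by
    refine tendsto_nhdsWithin_iff.2 ⟨hu, ?_⟩
    filter_upwards [eventually_gt_atTop 3] with x hx
    have := Real.log_pos (by linarith : (1 : ℝ) < x)
    exact (div_pos this (by linarith)).ne'
  have hslope : Tendsto (fun u : ℝ => (Real.exp u - 1) / u) (𝓝[≠] 0) (𝓝 1) := by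
    have := (Real.hasDerivAt_exp 0).tendsto_slope
    rw [Real.exp_zero] at this
    refine this.congr fun u => ?_
    simp [slope_def_field]
  have h1 := hslope.comp hu'
  have h2 := (Real.continuous_exp.tendsto 0).comp hu
  rw [Real.exp_zero] at h2
  have h3 : Tendsto (fun x : ℝ => (x - 3) / x) atTop (𝓝 1) := by
    have : Tendsto (fun x : ℝ => 1 - 3 / x) atTop (𝓝 (1 - 0)) :=
      tendsto_const_nhds.sub (tendsto_const_nhds.div_atTop tendsto_id)
    rw [sub_zero] at this
    refine this.congr' ?_
    filter_upwards [eventually_gt_atTop 0] with x hx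
    field_simp
  have h4 := (h3.mul h2).div h1 one_ne_zero
  rw [one_mul, div_one] at h4
  refine h4.congr' ?_
  filter_upwards [eventually_gt_atTop 3] with x hx
  have hlog := Real.log_pos (by linarith : (1 : ℝ) < x)
  have hupos : 0 < Real.log x / (x - 3) := div_pos hlog (by linarith)
  have hexp : 0 < Real.exp (Real.log x / (x - 3)) - 1 := by
    linarith [Real.add_one_lt_exp hupos.ne']
  have hx3 : x - 3 ≠ 0 := by linarith
  have hx0 : x ≠ 0 := by linarith
  rw [Real.rpow_def_of_pos (by linarith), mul_one_div]
  simp only [Function.comp_apply, Pi.div_apply]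
  field_simp

lemma rangeLength_isEquivalent :
    (fun d : ℕ => rangeLength d) ~[atTop] (fun d : ℕ => √(d : ℝ) / Real.log (d : ℝ)) := by
  have h1 : Tendsto (fun x : ℝ => Real.log x / x * ((x - 1) / 4)) atTop atTop := by
    have : Tendsto (fun x : ℝ => Real.log x * (1 / 8)) atTop atTop :=
      Real.tendsto_log_atTop.atTop_mul_const (by norm_num)
    refine tendsto_atTop_mono' _ ?_ this
    filter_upwards [eventually_ge_atTop 2] with x hx
    have hlog := Real.log_nonneg (by linarith : (1 : ℝ) ≤ x)
    rw [div_mul_eq_mul_div, mul_div_assoc]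
    refine mul_le_mul_of_nonneg_left ?_ hlog
    rw [le_div_iff₀ (by linarith)]
    linarith
  have h2 := tendsto_log_div_mul_rpow
  have hmin : ∀ᶠ x : ℝ in atTop,
      min ((x - 1) / 4) (x ^ (1 / (x - 3)) / (x ^ (1 / (x - 3)) - 1)) =
        x ^ (1 / (x - 3)) / (x ^ (1 / (x - 3)) - 1) := by
    filter_upwards [h1.eventually_ge_atTop 2, h2.eventually_lt_const one_lt_two,
      eventually_gt_atTop 1] with x hx1 hx2 hx3
    refine min_eq_right (le_of_mul_le_mul_left (hx2.le.trans hx1) ?_)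
    exact div_pos (Real.log_pos hx3) (by linarith)
  have hv : ∀ᶠ d : ℕ in atTop, √(d : ℝ) / Real.log d ≠ 0 := by
    filter_upwards [eventually_gt_atTop 1] with d hd
    have hd' : (1 : ℝ) < d := by exact_mod_cast hd
    have := Real.log_pos hd'
    have : (0 : ℝ) < √d := Real.sqrt_pos.2 (by linarith)
    positivity
  refine (isEquivalent_iff_tendsto_one hv).2 ?_
  refine (h2.comp tendsto_natCast_atTop_atTop).congr' ?_
  filter_upwards [tendsto_natCast_atTop_atTop.eventually hmin, eventually_gt_atTop 1] with d hd hd1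
  have hd' : (1 : ℝ) < d := by exact_mod_cast hd1
  have hlog := Real.log_pos hd'
  have hsq : √(d : ℝ) * √d = d := Real.mul_self_sqrt (by linarith)
  have hpos : (0 : ℝ) < √d := Real.sqrt_pos.2 (by linarith)
  simp only [Function.comp_apply, Pi.div_apply, rangeLength]
  rw [hd]
  generalize (d : ℝ) ^ (1 / ((d : ℝ) - 3)) / ((d : ℝ) ^ (1 / ((d : ℝ) - 3)) - 1) = r
  nth_rewrite 2 [← hsq]
  field_simp

theorem mainTheorem1 :
    (∀ (d : ℕ) (t : ℝ), 4 ≤ d →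
      √(d : ℝ) / 2 - rangeLength d < t → t < √(d : ℝ) / 2 →
      ∀ a ∈ Metric.sphere (0 : EuclideanSpace ℝ (Fin d)) 1,
        IsOrthogonalToDiagonal d (tangentHyperplane d t a) →
        IsStrictLocalMaxOn (sectionVolume d t) (Metric.sphere 0 1) a) ∧
    (fun d : ℕ => rangeLength d) ~[atTop] (fun d : ℕ => √(d : ℝ) / Real.log (d : ℝ)) := by
  refine ⟨fun d t hd ht ht' a ha had => ?_, rangeLength_isEquivalent⟩
  refine isStrictLocalMaxOn_sectionVolume hd (lt_of_le_of_lt ?_ ht) ht' ha had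
  have : rangeLength d ≤ ((d : ℝ) - 1) / 4 / √d := by
    rw [rangeLength, div_eq_mul_one_div (((d : ℝ) - 1) / 4), mul_comm]
    exact mul_le_mul_of_nonneg_right (min_le_left _ _) (by positivity)
  linarith
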